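/- Let $d\ge 1$ and $\alpha>d$, and let $(\xi(z))_{z\in\mathbb Z^d}$ be independent, identically Pareto-distributed random variables with parameter $\alpha$, that is, $\mathrm{Prob}(\xi(z)<x)=1-x^{-\alpha}$ for all $x\ge 1$. Let $u:[0,\infty)\times\mathbb Z^d\to[0,\infty)$ be the nonnegative solution of the parabolic Anderson problem $$\partial_t u(t,z)=\sum_{y\sim z}\bigl[u(t,y)-u(t,z)\bigr]+\xi(z)\,u(t,z)\quad (t>0,\ z\in\mathbb Z^d),\qquad u(0,z)=\mathbf 1\{z=0\},$$ where $y\sim z$ means that $y$ and $z$ are nearest neighbours and $u(\cdot,z)$ is continuous at time $0$, and let $U(t)=\sum_{z\in\mathbb Z^d}u(t,z)$ be its total mass. Write $|\cdot|$ for the $\ell^1$-norm on $\mathbb Z^d$, let $N(z)$ be the number of nearest neighbour paths of length $|z|$ in $\mathbb Z^d$ from $0$ to $z$, let $\eta(z)=\log N(z)$, and for $t>0$ put $$\Phi_t(z)=\Bigl[\xi(z)-\frac{|z|}{t}\log\xi(z)+\frac{\eta(z)}{t}\Bigr]\mathbf 1\{t\xi(z)\ge|z|\},\qquad z\in\mathbb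 Z^d.$$ Then, almost surely, $\Phi_t$ attains its maximum over $\mathbb Z^d$ for every $t>0$; and if $Z_t^{(1)}\in\mathbb Z^d$ denotes, for each $t>0$, any point with $\Phi_t(Z_t^{(1)})=\max_{z\in\mathbb Z^d}\Phi_t(z)$, then there are a (random) function $\varepsilon$ with $\varepsilon(t)\to0$ as $t\to\infty$ and a (random) time $t_0>0$ such that $$\frac1t\log U(t)\ \ge\ \Phi_t\bigl(Z_t^{(1)}\bigr)-2d+\varepsilon(t)\qquad\text{for all } t>t_0 .$$ -/

import Mathlib

open MeasureTheory ProbabilityTheory Filter Topology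

namespace PAM

/-- The integer lattice `ℤ^d`. -/
abbrev Lattice (d : ℕ) : Type := Fin d → ℤ

/-- The `ℓ¹`-norm `|z|` of a lattice point. -/
def l1norm {d : ℕ} (z : Lattice d) : ℕ := ∑ i, (z i).natAbs

/-- The nearest neighbour paths of length `n` (that is, with `n` steps) in `ℤ^d` that start at the
origin and pass through `z`. -/
def paths {d : ℕ} (n : ℕ) (z : Lattice d) : Set (Fin (n + 1) → Lattice d) :=
  {γ | γ 0 = 0 ∧ (∀ i : Fin n, l1norm (γ i.succ - γ i.castSucc) = 1) ∧ ∃ i, γ i = z}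

/-- `N(n, z)`, the number of these paths (a finite number). -/
noncomputable def pathCount {d : ℕ} (n : ℕ) (z : Lattice d) : ℕ := (paths n z).ncard

/-- `η(z) = log N(|z|, z)`. -/
noncomputable def eta {d : ℕ} (z : Lattice d) : ℝ := Real.log (pathCount (l1norm z) z)

/-- `Φ_t(z) = [ξ(z) - (|z|/t) log ξ(z) + η(z)/t] 1{t ξ(z) ≥ |z|}`, for a realisation `ξ` of the
potential. -/
noncomputable def Phi {d : ℕ} (ξ : Lattice d → ℝ) (t : ℝ) (z : Lattice d) : ℝ :=
  open Classical in
  if (l1norm z : ℝ) ≤ t * ξ z then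
    ξ z - (l1norm z : ℝ) / t * Real.log (ξ z) + eta z / t
  else 0

/-- `z` is a point at which `Φ_t` attains its maximum over `ℤ^d`. -/
def IsMaximizer {d : ℕ} (ξ : Lattice d → ℝ) (t : ℝ) (z : Lattice d) : Prop :=
  ∀ y, Phi ξ t y ≤ Phi ξ t z

/-- The discrete Laplacian `(Δ f)(z) = ∑_{y ∼ z} (f(y) - f(z))`; the neighbours of `z` are the
`2d` points `z ± e_i`. -/
def laplacian {d : ℕ} (f : Lattice d → ℝ) (z : Lattice d) : ℝ :=
  ∑ i, ((f (z + Pi.single i 1) - f z) + (f (z - Pi.single i 1) - f z))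

/-- `u` is a nonnegative solution of the Cauchy problem `∂_t u = Δ u + ξ u` on `(0, ∞) × ℤ^d`,
`u(0, ·) = 1_0`, where the initial value is attained continuously.
Only the values `u t z` with `0 ≤ t` matter. -/
structure IsNonnegSolution {d : ℕ} (ξ : Lattice d → ℝ) (u : ℝ → Lattice d → ℝ) : Prop where
  nonneg : ∀ t, 0 ≤ t → ∀ z, 0 ≤ u t z
  initial : ∀ z, u 0 z = if z = 0 then 1 else 0
  continuous_zero : ∀ z, ContinuousWithinAt (fun s => u s z) (Set.Ici 0) 0
  hasDerivAt : ∀ t, 0 < t → ∀ z,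
    HasDerivAt (fun s => u s z) (laplacian (u t) z + ξ z * u t z) t

/-- The total mass `U(t) = ∑_z u(t, z)`, a sum of nonnegative terms, taken in `[0, ∞]`. -/
noncomputable def totalMass {d : ℕ} (u : ℝ → Lattice d → ℝ) (t : ℝ) : ENNReal :=
  ∑' z, ENNReal.ofReal (u t z)

end PAM

/-!
A solution `u` dominates every contribution of the Feynman-Kac formula, and one strategy suffices:
walk from `0` to `z = Z_t` along a shortest path within time `s`, then stay at `z` until time `t`.
Everything is obtained from the differential inequalities, without constructing the random walk.

* Where `ξ ≥ 0`, the function `w(s, x) = e^{2ds} u(s, x)` satisfies `∂_s w(s, x) ≥ ∑_{y ∼ x} w(s, y)`.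
  Integrating this `k` times gives `w(s, x) ≥ M_k(x) s^k / k!`, with `M_k(x)` the number of walks of
  `k` steps from `0` to `x` (`walkCount_mul_pow_div_factorial_le`).
* At a fixed site `e^{(2d - ξ(z)) s} u(s, z)` is nondecreasing in `s` (`exp_mul_le`).

With `n = |z|`, the choice `s = n / ξ(z)`, which is at most `t` exactly on the event in the indicator
of `Φ_t`, and `log n! ≤ n log n - n + log n + 1`, these give
`log u(t, z) ≥ t Φ_t(z) - 2dt - log n - 1` (`mul_Phi_sub_le_log`).

The error is `o(t)` since `|Z_t|` grows at most polynomially. For `β < 1` with `αβ > d`,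
Borel-Cantelli gives `ξ(z) < |z|^β` for all but finitely many `z`
(`ae_finite_setOf_rpow_le`). Outside this finite set, `|z| ≤ t ξ(z)` forces
`|z| ≤ t^{1/(1-β)}` (`exists_bound_of_le_mul`). For fixed `t` this also makes the support of `Φ_t`
finite, so that the maximum is attained.
-/

namespace PAM

variable {d : ℕ}

/-! ### The `ℓ¹`-norm and walks on the lattice -/

@[simp] lemma l1norm_eq_zero {z : Lattice d} : l1norm z = 0 ↔ z = 0 := by
  simp [l1norm, funext_iff]

lemma l1norm_add_le (x y : Lattice d) : l1norm (x + y) ≤ l1norm x + l1norm y := by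
  unfold l1norm
  rw [← Finset.sum_add_distrib]
  exact Finset.sum_le_sum fun i _ => Int.natAbs_add_le _ _

lemma finite_setOf_l1norm_le (n : ℕ) : {z : Lattice d | l1norm z ≤ n}.Finite := by
  refine (Set.finite_Icc (fun _ => -(n : ℤ)) (fun _ => (n : ℤ))).subset fun z hz => ?_
  have h (i : Fin d) : (z i).natAbs ≤ n :=
    (Finset.single_le_sum (f := fun i => (z i).natAbs) (fun _ _ => Nat.zero_le _)
      (Finset.mem_univ i)).trans hz
  have h' (i : Fin d) : -(n : ℤ) ≤ z i ∧ z i ≤ n := by have := h i; omega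
  exact ⟨fun i => (h' i).1, fun i => (h' i).2⟩

lemma exists_eq_single_of_l1norm_eq_one {v : Lattice d} (h : l1norm v = 1) :
    ∃ i, v = Pi.single i 1 ∨ v = -Pi.single i 1 := by
  have hne : v ≠ 0 := fun h0 => by simp [h0, l1norm] at h
  obtain ⟨i, hi⟩ := Function.ne_iff.mp hne
  have hi' : v i ≠ 0 := hi
  have hsum := Finset.add_sum_erase Finset.univ (fun j => (v j).natAbs) (Finset.mem_univ i)
  unfold l1norm at h
  have h0 : ∑ j ∈ Finset.univ.erase i, (v j).natAbs = 0 := by omega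
  have hz : ∀ j, j ≠ i → v j = 0 := fun j hj => by
    simpa using Finset.sum_eq_zero_iff.mp h0 j (by simp [hj])
  have hv : v = Pi.single i (v i) := by
    ext j
    by_cases hj : j = i
    · subst hj; simp
    · simp [hj, hz j hj]
  have h1 : v i = 1 ∨ v i = -1 := by omega
  refine ⟨i, h1.imp (fun h => ?_) fun h => ?_⟩
  · rw [hv, h]
  · rw [hv, h, ← Pi.single_neg]

/-- Away from the origin a lattice point has a neighbour that is closer to the origin. -/
lemma exists_l1norm_step {n : ℕ} {z : Lattice d} (h : l1norm z = n + 1) :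
    ∃ i, l1norm (z + Pi.single i 1) = n ∨ l1norm (z - Pi.single i 1) = n := by
  have hne : z ≠ 0 := fun h0 => by simp [h0, l1norm] at h
  obtain ⟨i, hi⟩ := Function.ne_iff.mp hne
  have hi' : z i ≠ 0 := hi
  have hsum (y : Lattice d) : l1norm y = (y i).natAbs + ∑ j ∈ Finset.univ.erase i, (y j).natAbs :=
    (Finset.add_sum_erase Finset.univ (fun j => (y j).natAbs) (Finset.mem_univ i)).symm
  have hp : ∑ j ∈ Finset.univ.erase i, ((z + Pi.single i 1 : Lattice d) j).natAbs =
      ∑ j ∈ Finset.univ.erase i, (z j).natAbs :=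
    Finset.sum_congr rfl fun j hj => by simp [Finset.ne_of_mem_erase hj]
  have hm : ∑ j ∈ Finset.univ.erase i, ((z - Pi.single i 1 : Lattice d) j).natAbs =
      ∑ j ∈ Finset.univ.erase i, (z j).natAbs :=
    Finset.sum_congr rfl fun j hj => by simp [Finset.ne_of_mem_erase hj]
  refine ⟨i, ?_⟩
  rw [hsum, hp, hsum (z - _), hm]
  rw [hsum] at h
  simp only [Pi.add_apply, Pi.sub_apply, Pi.single_eq_same]
  omega

/-- The number of nearest neighbour walks with `k` steps from the origin to a given point, defined
by recursion on the last step. -/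
def walkCount : ℕ → Lattice d → ℕ
  | 0, x => if x = 0 then 1 else 0
  | k + 1, x => ∑ i, (walkCount k (x + Pi.single i 1) + walkCount k (x - Pi.single i 1))

lemma one_le_walkCount (n : ℕ) (z : Lattice d) (h : l1norm z = n) : 1 ≤ walkCount n z := by
  induction n generalizing z with
  | zero => simp [walkCount, l1norm_eq_zero.mp h]
  | succ n ih =>
    obtain ⟨i, hi⟩ := exists_l1norm_step h
    refine le_trans ?_ (Finset.single_le_sum (f := fun i =>
      walkCount n (z + Pi.single i 1) + walkCount n (z - Pi.single i 1))
      (fun _ _ => Nat.zero_le _) (Finset.mem_univ i))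
    rcases hi with hi | hi
    · exact (ih _ hi).trans (Nat.le_add_right _ _)
    · exact (ih _ hi).trans (Nat.le_add_left _ _)

/-- The nearest neighbour walks with `n` steps from the origin to `z`. -/
def walks (n : ℕ) (z : Lattice d) : Set (Fin (n + 1) → Lattice d) :=
  {γ | γ 0 = 0 ∧ (∀ i : Fin n, l1norm (γ i.succ - γ i.castSucc) = 1) ∧ γ (Fin.last n) = z}

lemma walks_succ_subset (n : ℕ) (z : Lattice d) :
    walks (n + 1) z ⊆ ⋃ i, ((fun γ => (Fin.snoc γ z : Fin (n + 1 + 1) → Lattice d)) ''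
      walks n (z + Pi.single i 1) ∪
        (fun γ => (Fin.snoc γ z : Fin (n + 1 + 1) → Lattice d)) '' walks n (z - Pi.single i 1)) := by
  rintro γ ⟨h0, hstep, hlast⟩
  have hγ : (Fin.snoc (Fin.init γ) z : Fin (n + 1 + 1) → Lattice d) = γ := by
    rw [← hlast, Fin.snoc_init_self]
  have hinit (y : Lattice d) (hy : Fin.init γ (Fin.last n) = y) : Fin.init γ ∈ walks n y :=
    ⟨h0, fun i => hstep i.castSucc, hy⟩
  obtain ⟨i, hi⟩ := exists_eq_single_of_l1norm_eq_one (hstep (Fin.last n))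
  rw [Fin.succ_last, hlast] at hi
  refine Set.mem_iUnion.mpr ⟨i, hi.symm.imp (fun hi => ⟨_, hinit _ ?_, hγ⟩)
    fun hi => ⟨_, hinit _ ?_, hγ⟩⟩
  · rw [Fin.init, ← neg_eq_iff_eq_neg.mpr hi]; abel
  · rw [Fin.init, ← hi]; abel

lemma finite_walks_and_ncard_le (n : ℕ) (z : Lattice d) :
    (walks n z).Finite ∧ (walks n z).ncard ≤ walkCount n z := by
  induction n generalizing z with
  | zero =>
    have hsub : walks 0 z ⊆ {fun _ => (0 : Lattice d)} := fun γ hγ => by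
      refine funext fun i => ?_
      rw [Fin.fin_one_eq_zero i]
      exact hγ.1
    refine ⟨(Set.finite_singleton _).subset hsub, ?_⟩
    by_cases hz : z = 0
    · simpa [walkCount, hz] using Set.ncard_le_ncard hsub
    · have : walks 0 z = ∅ := Set.eq_empty_of_forall_notMem fun γ hγ =>
        hz (hγ.2.2.symm.trans hγ.1)
      simp [this]
  | succ n ih =>
    have hfin := Set.finite_iUnion fun i : Fin d =>
      ((ih (z + Pi.single i 1)).1.image
        fun γ => (Fin.snoc γ z : Fin (n + 1 + 1) → Lattice d)).union
      ((ih (z - Pi.single i 1)).1.image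
        fun γ => (Fin.snoc γ z : Fin (n + 1 + 1) → Lattice d))
    refine ⟨hfin.subset (walks_succ_subset n z),
      (Set.ncard_le_ncard (walks_succ_subset n z) hfin).trans
        ((Set.ncard_iUnion_le_of_fintype _).trans (Finset.sum_le_sum fun i _ => ?_))⟩
    refine (Set.ncard_union_le _ _).trans (add_le_add ?_ ?_)
    · exact (Set.ncard_image_le (ih _).1).trans (ih _).2
    · exact (Set.ncard_image_le (ih _).1).trans (ih _).2

/-- A walk from the origin needs at least `|z|` steps to reach `z`, so that a walk of `|z|` steps
that passes through `z` ends there. -/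
lemma paths_l1norm_subset_walks (z : Lattice d) : paths (l1norm z) z ⊆ walks (l1norm z) z := by
  rintro γ ⟨h0, hstep, i, hi⟩
  have hle : ∀ i : Fin (l1norm z + 1), l1norm (γ i) ≤ i := by
    intro i
    induction i using Fin.induction with
    | zero => simp [h0, l1norm]
    | succ i ih =>
      have := l1norm_add_le (γ i.succ - γ i.castSucc) (γ i.castSucc)
      rw [sub_add_cancel, hstep] at this
      simp only [Fin.val_castSucc, Fin.val_succ] at ih ⊢
      omega
  refine ⟨h0, hstep, ?_⟩
  have h1 := hle i
  rw [hi] at h1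
  have h2 : i = Fin.last (l1norm z) := Fin.ext (le_antisymm (Fin.le_last i) h1)
  rw [← h2, hi]

lemma eta_le_log_walkCount (z : Lattice d) : eta z ≤ Real.log (walkCount (l1norm z) z) := by
  have hle : pathCount (l1norm z) z ≤ walkCount (l1norm z) z :=
    (Set.ncard_le_ncard (paths_l1norm_subset_walks z) (finite_walks_and_ncard_le _ z).1).trans
      (finite_walks_and_ncard_le _ z).2
  unfold eta
  rcases Nat.eq_zero_or_pos (pathCount (l1norm z) z) with h | h
  · rw [h, Nat.cast_zero, Real.log_zero]
    exact Real.log_natCast_nonneg _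
  · exact Real.log_le_log (by exact_mod_cast h) (by exact_mod_cast hle)

/-! ### Lower bounds for nonnegative solutions -/

lemma laplacian_eq (f : Lattice d → ℝ) (z : Lattice d) :
    laplacian f z = ∑ i, (f (z + Pi.single i 1) + f (z - Pi.single i 1)) - 2 * d * f z := by
  have h (i : Fin d) : (f (z + Pi.single i 1) - f z) + (f (z - Pi.single i 1) - f z) =
      (f (z + Pi.single i 1) + f (z - Pi.single i 1)) - 2 * f z := by ring
  simp only [laplacian, h, Finset.sum_sub_distrib, Finset.sum_const, Finset.card_univ,
    Fintype.card_fin, nsmul_eq_mul]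
  ring

namespace IsNonnegSolution

variable {ξ : Lattice d → ℝ} {u : ℝ → Lattice d → ℝ}

lemma continuousOn (hu : IsNonnegSolution ξ u) (z : Lattice d) :
    ContinuousOn (fun s => u s z) (Set.Ici 0) := by
  intro s hs
  rcases eq_or_lt_of_le (Set.mem_Ici.mp hs) with rfl | hs
  · exact hu.continuous_zero z
  · exact (hu.hasDerivAt s hs z).continuousAt.continuousWithinAt

/-- The exponential weight removes the diagonal term of the equation. -/
lemma hasDerivAt_exp_mul (hu : IsNonnegSolution ξ u) (c : ℝ) {t : ℝ} (ht : 0 < t) (z : Lattice d) :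
    HasDerivAt (fun s => Real.exp (c * s) * u s z)
      (Real.exp (c * t) * (∑ i, (u t (z + Pi.single i 1) + u t (z - Pi.single i 1)) +
        (c - 2 * d + ξ z) * u t z)) t := by
  refine ((((hasDerivAt_id t).const_mul c).exp).mul (hu.hasDerivAt t ht z)).congr_deriv ?_
  rw [laplacian_eq]
  simp only [id]
  ring

lemma sum_neighbours_nonneg (hu : IsNonnegSolution ξ u) {t : ℝ} (ht : 0 ≤ t) (z : Lattice d) :
    0 ≤ ∑ i, (u t (z + Pi.single i 1) + u t (z - Pi.single i 1)) :=
  Finset.sum_nonneg fun _ _ => add_nonneg (hu.nonneg t ht _) (hu.nonneg t ht _)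

/-- The mass at a site grows at least at the rate obtained by never leaving the site. -/
lemma exp_mul_le (hu : IsNonnegSolution ξ u) (z : Lattice d) {s t : ℝ} (hs : 0 ≤ s) (hst : s ≤ t) :
    Real.exp ((ξ z - 2 * d) * (t - s)) * u s z ≤ u t z := by
  have hmono : MonotoneOn (fun r => Real.exp ((2 * d - ξ z) * r) * u r z) (Set.Ici 0) := by
    refine monotoneOn_of_hasDerivWithinAt_nonneg (convex_Ici 0)
      ((by fun_prop : Continuous fun r : ℝ => Real.exp ((2 * d - ξ z) * r)).continuousOn.mul
        (hu.continuousOn z))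
      (fun r hr => (hu.hasDerivAt_exp_mul _ (by simpa using hr) z).hasDerivWithinAt) fun r hr => ?_
    have hr' : 0 < r := by simpa using hr
    have := hu.sum_neighbours_nonneg hr'.le z
    have h0 : 2 * (d : ℝ) - ξ z - 2 * d + ξ z = 0 := by ring
    rw [h0, zero_mul, add_zero]
    positivity
  have h := mul_le_mul_of_nonneg_left (hmono hs (hs.trans hst) hst)
    (Real.exp_pos ((ξ z - 2 * d) * t)).le
  simp only [← mul_assoc, ← Real.exp_add] at h
  have e1 : (ξ z - 2 * d) * t + (2 * d - ξ z) * s = (ξ z - 2 * d) * (t - s) := by ring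
  have e2 : (ξ z - 2 * d) * t + (2 * d - ξ z) * t = 0 := by ring
  rwa [e1, e2, Real.exp_zero, one_mul] at h

/-- Only walks that make exactly `k` steps up to time `s` are counted, and the potential along them
is bounded below by `0`. -/
lemma walkCount_mul_pow_div_factorial_le (hu : IsNonnegSolution ξ u) (hξ : ∀ z, 0 ≤ ξ z) (k : ℕ)
    (x : Lattice d) {s : ℝ} (hs : 0 ≤ s) :
    walkCount k x * (s ^ k / k.factorial) ≤ Real.exp (2 * d * s) * u s x := by
  induction k generalizing x s with
  | zero =>
    by_cases hx : x = 0
    · have h := hu.exp_mul_le x le_rfl hs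
      rw [hu.initial, if_pos hx, mul_one, sub_zero] at h
      have h2 := mul_le_mul_of_nonneg_left h (Real.exp_pos (2 * d * s)).le
      rw [← Real.exp_add] at h2
      have h3 : (1 : ℝ) ≤ Real.exp (2 * d * s + (ξ x - 2 * d) * s) :=
        Real.one_le_exp (by nlinarith [mul_nonneg (hξ x) hs])
      simpa [walkCount, hx] using h3.trans h2
    · simpa [walkCount, hx] using mul_nonneg (Real.exp_pos (2 * d * s)).le (hu.nonneg s hs x)
  | succ k ih =>
    have hpow (r : ℝ) : HasDerivAt (fun r : ℝ => (walkCount (k + 1) x : ℝ) *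
        (r ^ (k + 1) / (k + 1).factorial)) (walkCount (k + 1) x * (r ^ k / k.factorial)) r := by
      refine (((hasDerivAt_pow (k + 1) r).div_const ((k + 1).factorial : ℝ)).const_mul
        (walkCount (k + 1) x : ℝ)).congr_deriv ?_
      rw [Nat.factorial_succ]
      push_cast
      have : (k.factorial : ℝ) ≠ 0 := by positivity
      have : (k : ℝ) + 1 ≠ 0 := by positivity
      field_simp
    have hmono : MonotoneOn (fun r => Real.exp (2 * d * r) * u r x -
        walkCount (k + 1) x * (r ^ (k + 1) / (k + 1).factorial)) (Set.Ici 0) := by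
      refine monotoneOn_of_hasDerivWithinAt_nonneg (convex_Ici 0)
        (((by fun_prop : Continuous fun r : ℝ => Real.exp (2 * d * r)).continuousOn.mul
          (hu.continuousOn x)).sub (by fun_prop))
        (fun r hr => ((hu.hasDerivAt_exp_mul _ (by simpa using hr) x).sub
          (hpow r)).hasDerivWithinAt) fun r hr => ?_
      have hr' : 0 < r := by simpa using hr
      have hsum : (walkCount (k + 1) x : ℝ) * (r ^ k / k.factorial) ≤ Real.exp (2 * d * r) *
          ∑ i, (u r (x + Pi.single i 1) + u r (x - Pi.single i 1)) := by
        rw [walkCount, Nat.cast_sum, Finset.sum_mul, Finset.mul_sum]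
        refine Finset.sum_le_sum fun i _ => ?_
        rw [Nat.cast_add, add_mul, mul_add]
        exact add_le_add (ih _ hr'.le) (ih _ hr'.le)
      have hpot := mul_nonneg (Real.exp_pos (2 * d * r)).le
        (mul_nonneg (hξ x) (hu.nonneg r hr'.le x))
      have h0 : 2 * (d : ℝ) - 2 * d + ξ x = ξ x := by ring
      rw [h0, mul_add]
      linarith
    have h := hmono (Set.mem_Ici.mpr le_rfl) hs hs
    have h0 := hu.nonneg 0 le_rfl x
    simp at h
    linarith

end IsNonnegSolution

/-- With the junk value `log 0 = 0` the bound holds at `n = 0` too. -/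
lemma log_factorial_le (n : ℕ) : Real.log n.factorial ≤ n * Real.log n - n + Real.log n + 1 := by
  rcases Nat.eq_zero_or_pos n with rfl | hn
  · simp
  induction n, hn using Nat.le_induction with
  | base => simp
  | succ n hn ih =>
    have hn0 : (0 : ℝ) < n := by exact_mod_cast hn
    have h1 : (0 : ℝ) < (n : ℝ) + 1 := by positivity
    have hlog := Real.one_sub_inv_le_log_of_pos (div_pos h1 hn0)
    rw [Real.log_div h1.ne' hn0.ne', inv_div] at hlog
    have hstep : 1 ≤ ((n : ℝ) + 1) * (Real.log (n + 1) - Real.log n) := by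
      refine le_trans (le_of_eq ?_) (mul_le_mul_of_nonneg_left hlog h1.le)
      field_simp
      ring
    rw [Nat.factorial_succ]
    push_cast
    rw [Real.log_mul h1.ne' (by positivity)]
    nlinarith

/-- The lower bound for one site: spend time `|z| / ξ(z)` on the way to `z` and the remaining time
at `z`. -/
lemma IsNonnegSolution.mul_Phi_sub_le_log {ξ : Lattice d → ℝ} {u : ℝ → Lattice d → ℝ}
    (hu : IsNonnegSolution ξ u) (hξ : ∀ z, 1 ≤ ξ z) {t : ℝ} (ht : 0 < t) {z : Lattice d}
    (hz : (l1norm z : ℝ) ≤ t * ξ z) :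
    0 < u t z ∧
      t * Phi ξ t z - 2 * d * t - Real.log (l1norm z) - 1 ≤ Real.log (u t z) := by
  set n := l1norm z with hn
  have hx : 0 < ξ z := one_pos.trans_le (hξ z)
  set s : ℝ := n / ξ z with hs
  have hs0 : 0 ≤ s := by positivity
  have hst : s ≤ t := (div_le_iff₀ hx).mpr hz
  have hM : (0 : ℝ) < walkCount n z := by exact_mod_cast one_le_walkCount n z rfl
  -- For `z = 0` both `n` and `s` vanish, and `0 ^ 0 = 1`.
  have hpow : 0 < s ^ n := by
    rcases Nat.eq_zero_or_pos n with h | h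
    · simp [h]
    · have : (0 : ℝ) < n := by exact_mod_cast h
      positivity
  have hwalk := hu.walkCount_mul_pow_div_factorial_le (fun z => one_pos.le.trans (hξ z)) n z hs0
  have hstay := hu.exp_mul_le z hs0 hst
  have hfac : (0 : ℝ) < n.factorial := by positivity
  have hlow : 0 < walkCount n z * (s ^ n / n.factorial) := by positivity
  have hus : 0 < u s z := by
    have := hlow.trans_le hwalk
    exact (mul_pos_iff_of_pos_left (Real.exp_pos _)).mp this
  have hut : 0 < u t z := (mul_pos (Real.exp_pos _) hus).trans_le hstay
  refine ⟨hut, ?_⟩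
  have l1 := Real.log_le_log hlow hwalk
  have l2 := Real.log_le_log (mul_pos (Real.exp_pos _) hus) hstay
  rw [Real.log_mul hM.ne' (by positivity), Real.log_div hpow.ne' hfac.ne', Real.log_pow,
    Real.log_mul (Real.exp_pos _).ne' hus.ne', Real.log_exp] at l1
  rw [Real.log_mul (Real.exp_pos _).ne' hus.ne', Real.log_exp] at l2
  have hlogs : n * Real.log s = n * Real.log n - n * Real.log (ξ z) := by
    rcases Nat.eq_zero_or_pos n with h | h
    · simp [h]
    · rw [hs, Real.log_div (by positivity) hx.ne']; ring
  have hsx : s * ξ z = n := div_mul_cancel₀ _ hx.ne'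
  have hfacle := log_factorial_le n
  have heta := eta_le_log_walkCount z
  have hPhi : t * Phi ξ t z = t * ξ z - n * Real.log (ξ z) + eta z := by
    rw [Phi, if_pos hz, ← hn]
    field_simp
  rw [hPhi]
  nlinarith

/-! ### The maximizer for a potential of sublinear growth -/

/-- Where the potential satisfies `ξ(z) < |z|^β` outside a finite set, the support of `Φ_t` has a
radius that is polynomial in `t`. -/
lemma exists_bound_of_le_mul {ξ : Lattice d → ℝ} {β : ℝ} (hβ : β < 1)
    (hfin : {z : Lattice d | z ≠ 0 ∧ (l1norm z : ℝ) ^ β ≤ ξ z}.Finite) :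
    ∃ K : ℕ, ∀ t : ℝ, 0 ≤ t → ∀ z : Lattice d, (l1norm z : ℝ) ≤ t * ξ z →
      (l1norm z : ℝ) ≤ K + t ^ (1 - β)⁻¹ := by
  obtain ⟨K, hK⟩ := (hfin.image l1norm).bddAbove
  refine ⟨K, fun t ht z hz => ?_⟩
  by_cases hz0 : z = 0
  · have : l1norm z = 0 := l1norm_eq_zero.mpr hz0
    rw [this, Nat.cast_zero]
    positivity
  by_cases hmem : (l1norm z : ℝ) ^ β ≤ ξ z
  · have : (l1norm z : ℝ) ≤ K := by exact_mod_cast hK ⟨z, ⟨hz0, hmem⟩, rfl⟩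
    have := Real.rpow_nonneg ht (1 - β)⁻¹
    linarith
  · have hpos : (0 : ℝ) < l1norm z := by
      exact_mod_cast Nat.pos_of_ne_zero (mt l1norm_eq_zero.mp hz0)
    have h1 : (l1norm z : ℝ) ≤ t * (l1norm z : ℝ) ^ β :=
      hz.trans (mul_le_mul_of_nonneg_left (not_le.mp hmem).le ht)
    have h2 : (l1norm z : ℝ) ^ (1 - β) ≤ t := by
      rwa [Real.rpow_sub hpos, Real.rpow_one, div_le_iff₀ (by positivity)]
    have h3 := Real.rpow_le_rpow (by positivity) h2 (inv_nonneg.mpr (sub_nonneg.mpr hβ.le))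
    rw [Real.rpow_rpow_inv hpos.le (sub_pos.mpr hβ).ne'] at h3
    have : (0 : ℝ) ≤ K := Nat.cast_nonneg K
    linarith

lemma Phi_zero (ξ : Lattice d → ℝ) {t : ℝ} (ht : 0 ≤ t) (h0 : 0 ≤ ξ 0) :
    Phi ξ t 0 = ξ 0 + eta (0 : Lattice d) / t := by
  have h : l1norm (0 : Lattice d) = 0 := l1norm_eq_zero.mpr rfl
  rw [Phi, h, if_pos (by rw [Nat.cast_zero]; positivity)]
  simp

lemma Phi_zero_pos {ξ : Lattice d → ℝ} {t : ℝ} (ht : 0 ≤ t) (h0 : 0 < ξ 0) : 0 < Phi ξ t 0 := by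
  rw [Phi_zero ξ ht h0.le]
  exact add_pos_of_pos_of_nonneg h0 (div_nonneg (Real.log_natCast_nonneg _) ht)

lemma exists_isMaximizer {ξ : Lattice d → ℝ} {t : ℝ} (ht : 0 ≤ t) (h0 : 0 < ξ 0)
    (hfin : {z : Lattice d | (l1norm z : ℝ) ≤ t * ξ z}.Finite) : ∃ z, IsMaximizer ξ t z := by
  have hmem : (0 : Lattice d) ∈ {z : Lattice d | (l1norm z : ℝ) ≤ t * ξ z} := by
    rw [Set.mem_ofPred_eq, l1norm_eq_zero.mpr rfl, Nat.cast_zero]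
    positivity
  obtain ⟨z, -, hz⟩ := Set.exists_max_image _ (Phi ξ t) hfin ⟨0, hmem⟩
  refine ⟨z, fun y => ?_⟩
  by_cases hy : (l1norm y : ℝ) ≤ t * ξ y
  · exact hz y hy
  · rw [Phi, if_neg hy]
    exact (Phi_zero_pos ht h0).le.trans (hz 0 hmem)

lemma IsMaximizer.l1norm_le {ξ : Lattice d → ℝ} {t : ℝ} {z : Lattice d} (hz : IsMaximizer ξ t z)
    (ht : 0 ≤ t) (h0 : 0 < ξ 0) : (l1norm z : ℝ) ≤ t * ξ z := by
  by_contra h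
  have h1 := (Phi_zero_pos ht h0).trans_le (hz 0)
  rw [Phi, if_neg h] at h1
  exact h1.false

/-! ### Growth of the Pareto potential -/

lemma summable_l1norm_rpow {r : ℝ} (hr : (d : ℝ) < r) :
    Summable fun z : Lattice d => (l1norm z : ℝ) ^ (-r) := by
  let b := Pi.basisFun ℝ (Fin d)
  let L := Submodule.span ℤ (Set.range b)
  have hrank : Module.finrank ℤ L = d := by
    rw [ZLattice.rank ℝ L]; simp
  have hmem (z : Lattice d) : (fun i => (z i : ℝ)) ∈ L := by
    rw [Module.Basis.mem_span_iff_repr_mem]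
    intro i
    simp [b]
  let f : Lattice d → L := fun z => ⟨_, hmem z⟩
  have hf : Function.Injective f := fun x y h => by
    ext i
    exact Int.cast_injective (α := ℝ) (congrFun (congrArg Subtype.val h) i)
  have hsum := (ZLattice.summable_norm_rpow L (-r) (by rw [hrank]; linarith)).comp_injective hf
  refine Summable.of_nonneg_of_le (fun z => by positivity) (fun z => ?_) hsum
  have hr0 : 0 < r := (Nat.cast_nonneg d).trans_lt hr
  by_cases hz : z = 0
  · have : l1norm z = 0 := l1norm_eq_zero.mpr hz
    rw [this, Nat.cast_zero, Real.zero_rpow (by linarith)]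
    exact Real.rpow_nonneg (norm_nonneg _) _
  have hle : ‖f z‖ ≤ l1norm z := by
    refine (pi_norm_le_iff_of_nonneg (Nat.cast_nonneg _)).mpr fun i => ?_
    have h : (z i).natAbs ≤ l1norm z :=
      Finset.single_le_sum (f := fun i => (z i).natAbs) (fun _ _ => Nat.zero_le _)
        (Finset.mem_univ i)
    have h' : ((z i).natAbs : ℝ) ≤ l1norm z := by exact_mod_cast h
    simpa [f, Real.norm_eq_abs, Nat.cast_natAbs] using h'
  have hpos : 0 < ‖f z‖ := by
    rw [norm_pos_iff]
    intro h
    refine hz (hf (h.trans ?_))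
    ext i
    simp [f]
  exact Real.rpow_le_rpow_of_nonpos hpos hle (by linarith)

variable {Ω : Type*} [MeasurableSpace Ω] {P : Measure Ω} [IsProbabilityMeasure P] {α : ℝ}

lemma ae_one_le {X : Ω → ℝ} (hX : P.real {ω | X ω < 1} = 0) : ∀ᵐ ω ∂P, 1 ≤ X ω := by
  rw [measureReal_eq_zero_iff] at hX
  simpa [ae_iff] using hX

/-- By Borel-Cantelli, the Pareto potential eventually stays below `|z|^β` when `αβ > d`. -/
lemma ae_finite_setOf_rpow_le {ξ : Lattice d → Ω → ℝ} (hmeas : ∀ z, Measurable (ξ z))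
    (hpareto : ∀ z, ∀ x : ℝ, 1 ≤ x → P.real {ω | ξ z ω < x} = 1 - x ^ (-α)) {β : ℝ}
    (hβ : 0 ≤ β) (hαβ : (d : ℝ) < α * β) :
    ∀ᵐ ω ∂P, {z : Lattice d | z ≠ 0 ∧ (l1norm z : ℝ) ^ β ≤ ξ z ω}.Finite := by
  refine ae_finite_setOfPred_mem (s := fun z => {ω | z ≠ 0 ∧ (l1norm z : ℝ) ^ β ≤ ξ z ω}) ?_
  refine ne_top_of_le_ne_top (summable_l1norm_rpow hαβ).tsum_ofReal_ne_top
    (ENNReal.tsum_le_tsum fun z => ?_)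
  by_cases hz : z = 0
  · simp [hz]
  have h1 : (1 : ℝ) ≤ l1norm z := by
    exact_mod_cast Nat.one_le_iff_ne_zero.mpr (mt l1norm_eq_zero.mp hz)
  have hset : {ω | z ≠ 0 ∧ (l1norm z : ℝ) ^ β ≤ ξ z ω} = {ω | ξ z ω < (l1norm z : ℝ) ^ β}ᶜ := by
    ext ω
    simp [hz]
  rw [hset, ← ofReal_measureReal,
    probReal_compl_eq_one_sub (measurableSet_lt (hmeas z) measurable_const),
    hpareto z _ (Real.one_le_rpow h1 hβ), sub_sub_cancel, ← Real.rpow_mul (by positivity)]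
  exact ENNReal.ofReal_le_ofReal (le_of_eq (by ring_nf))

end PAM

/-! ### The lower bound for the total mass -/

theorem proposition4p2 {Ω : Type*} [MeasurableSpace Ω] (P : Measure Ω) [IsProbabilityMeasure P]
    (d : ℕ) (hd : 1 ≤ d) (α : ℝ) (hα : (d : ℝ) < α)
    (ξ : PAM.Lattice d → Ω → ℝ)
    (hξ_meas : ∀ z, Measurable (ξ z))
    (hξ_indep : iIndepFun ξ P)
    (hξ_pareto : ∀ z, ∀ x : ℝ, 1 ≤ x → P.real {ω | ξ z ω < x} = 1 - x ^ (-α)) :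
    ∀ᵐ ω ∂P,
      (∀ t : ℝ, 0 < t → ∃ z, PAM.IsMaximizer (fun y => ξ y ω) t z) ∧
      ∀ Z : ℝ → PAM.Lattice d, (∀ t : ℝ, 0 < t → PAM.IsMaximizer (fun y => ξ y ω) t (Z t)) →
      ∀ u : ℝ → PAM.Lattice d → ℝ, PAM.IsNonnegSolution (fun y => ξ y ω) u →
        ∃ ε : ℝ → ℝ, Tendsto ε atTop (𝓝 0) ∧ ∃ t₀ : ℝ, 0 < t₀ ∧ ∀ t : ℝ, t₀ < t →
          ((PAM.Phi (fun y => ξ y ω) t (Z t) - 2 * (d : ℝ) + ε t : ℝ) : EReal) ≤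
            ((1 / t : ℝ) : EReal) * ENNReal.log (PAM.totalMass u t) := by
  have hα0 : 0 < α := (Nat.cast_nonneg d).trans_lt hα
  -- Any `β` strictly between `d / α` and `1` works.
  obtain ⟨β, hβ, hβ1⟩ := exists_between ((div_lt_one hα0).mpr hα)
  have hβ0 : 0 ≤ β := (div_nonneg (Nat.cast_nonneg d) hα0.le).trans hβ.le
  have hαβ : (d : ℝ) < α * β := by rwa [div_lt_iff₀' hα0] at hβ
  have hone : ∀ᵐ ω ∂P, ∀ z, 1 ≤ ξ z ω := ae_all_iff.mpr fun z =>
    PAM.ae_one_le (by rw [hξ_pareto z 1 le_rfl]; simp)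
  filter_upwards [hone, PAM.ae_finite_setOf_rpow_le hξ_meas hξ_pareto hβ0 hαβ] with ω h1 hfin
  obtain ⟨K, hK⟩ := PAM.exists_bound_of_le_mul hβ1 hfin
  have h0 : 0 < ξ 0 ω := one_pos.trans_le (h1 0)
  refine ⟨fun t ht => ?_, fun Z hZ u hu => ?_⟩
  · refine PAM.exists_isMaximizer ht.le h0
      ((PAM.finite_setOf_l1norm_le ⌊K + t ^ (1 - β)⁻¹⌋₊).subset fun z hz => ?_)
    exact Nat.le_floor (hK t ht.le z hz)
  set γ := (1 - β)⁻¹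
  have hγ0 : 0 ≤ γ := inv_nonneg.mpr (sub_nonneg.mpr hβ1.le)
  refine ⟨fun t => -((Real.log (K + 1) + 1) * t⁻¹ + γ * (Real.log t / t)), ?_, 1, one_pos,
    fun t ht => ?_⟩
  · have hlog : Tendsto (fun t : ℝ => Real.log t / t) atTop (𝓝 0) :=
      Real.isLittleO_log_id_atTop.tendsto_div_nhds_zero
    simpa using ((tendsto_inv_atTop_zero.const_mul (Real.log (K + 1) + 1)).add
      (hlog.const_mul γ)).neg
  have ht0 : 0 < t := one_pos.trans ht
  have hsupp := (hZ t ht0).l1norm_le ht0.le h0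
  obtain ⟨hpos, hlow⟩ := hu.mul_Phi_sub_le_log h1 ht0 hsupp
  have hnorm : Real.log (PAM.l1norm (Z t)) ≤ Real.log (K + 1) + γ * Real.log t := by
    have htγ : 1 ≤ t ^ γ := Real.one_le_rpow ht.le hγ0
    have hK0 : (0 : ℝ) ≤ K := Nat.cast_nonneg K
    rcases Nat.eq_zero_or_pos (PAM.l1norm (Z t)) with h | h
    · rw [h, Nat.cast_zero, Real.log_zero]
      exact add_nonneg (Real.log_nonneg (by linarith)) (mul_nonneg hγ0 (Real.log_nonneg ht.le))
    · rw [← Real.log_rpow ht0, ← Real.log_mul (by positivity) (by positivity)]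
      refine Real.log_le_log (by exact_mod_cast h) ((hK t ht0.le _ hsupp).trans ?_)
      nlinarith
  have hmass : ((Real.log (u t (Z t)) : ℝ) : EReal) ≤ ENNReal.log (PAM.totalMass u t) := by
    rw [← ENNReal.log_ofReal_of_pos hpos]
    exact ENNReal.log_le_log (ENNReal.le_tsum (f := fun z => ENNReal.ofReal (u t z)) (Z t))
  refine le_trans ?_ (mul_le_mul_of_nonneg_left hmass
    (EReal.coe_nonneg.mpr (one_div_pos.mpr ht0).le))
  rw [← EReal.coe_mul, EReal.coe_le_coe_iff, one_div_mul_eq_div, le_div_iff₀ ht0]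
  have hcancel : (PAM.Phi (fun y => ξ y ω) t (Z t) - 2 * (d : ℝ) +
      -((Real.log (K + 1) + 1) * t⁻¹ + γ * (Real.log t / t))) * t =
      t * PAM.Phi (fun y => ξ y ω) t (Z t) - 2 * d * t - (Real.log (K + 1) + γ * Real.log t) -
        1 := by
    field_simp
    ring
  rw [hcancel]
  linarith
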